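/- Let $n\ge 0$ and $N_s\ge 2$ be integers, let $\mu\in\mathbb{R}^n$, and let $\Sigma\in\mathbb{R}^{n\times n}$ be symmetric positive semidefinite. Let $d_1,\dots,d_{N_s}$ be independent random vectors, each with the Gaussian law $\mathcal{N}(\mu,\Sigma)$, and form the sample mean and the sample covariance $$\hat\mu=\frac1{N_s}\sum_{i=1}^{N_s}d_i,\qquad \hat\Sigma=\frac1{N_s-1}\sum_{i=1}^{N_s}(d_i-\hat\mu)(d_i-\hat\mu)^\top .$$ Let $\beta\in(0,1)$ and put $$r_2=\max\left\{\left|1-\frac{N_s-1}{\chi^2_{N_s-1,1-\beta/2}}\right|,\ \left|1-\frac{N_s-1}{\chi^2_{N_s-1,\beta/2}}\right|\right\},$$ where $\chi^2_{k,p}$ denotes the $p$-th quantile of the chi-squared distribution with $k$ degrees of freedom, that is, of the law of $z_1^2+\dots+z_k^2$ for independent standard normal $z_1,\dots,z_k$. Then, for every fixed (deterministic) $x\in\mathbb{R}^n$, $$\Pr\left(\left|x^\top(\Sigma-\hat\Sigma)x\right|\le r_2\, x^\top\hat\Sigma x\right)\ \ge\ 1-\beta .$$ -/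

import Mathlib

open MeasureTheory ProbabilityTheory Matrix

noncomputable section

/-- The chi-squared distribution with `k` degrees of freedom: the law of `z₁² + ⋯ + z_k²`
for independent standard normal variables `z₁, …, z_k`. -/
def chiSquared (k : ℕ) : Measure ℝ :=
  (Measure.pi fun _ : Fin k => gaussianReal 0 1).map fun z => ∑ i, z i ^ 2

/-- The `p`-th quantile of a probability distribution `ν` on the real line, for `0 < p < 1`. -/
def quantile (ν : Measure ℝ) (p : ℝ) : ℝ :=
  sInf {t : ℝ | p ≤ cdf ν t}

/-- The `p`-th quantile of the chi-squared distribution with `k` degrees of freedom. -/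
def chiSquaredQuantile (k : ℕ) (p : ℝ) : ℝ :=
  quantile (chiSquared k) p

/-- The sample mean of `N` vectors. -/
def sampleMean {n N : ℕ} (d : Fin N → EuclideanSpace ℝ (Fin n)) : EuclideanSpace ℝ (Fin n) :=
  (1 / (N : ℝ)) • ∑ i, d i

/-- The sample covariance matrix of `N` vectors, normalized by `N - 1`. -/
def sampleCovariance {n N : ℕ} (d : Fin N → EuclideanSpace ℝ (Fin n)) :
    Matrix (Fin n) (Fin n) ℝ :=
  (1 / ((N : ℝ) - 1)) •
    ∑ i, vecMulVec (WithLp.ofLp (d i - sampleMean d)) (WithLp.ofLp (d i - sampleMean d))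

/-- The constant `r₂` for `N` samples and confidence level `1 - β`. -/
def covarianceRadius (N : ℕ) (β : ℝ) : ℝ :=
  max |1 - ((N : ℝ) - 1) / chiSquaredQuantile (N - 1) (1 - β / 2)|
    |1 - ((N : ℝ) - 1) / chiSquaredQuantile (N - 1) (β / 2)|

end

/-!
Projecting on `x` turns the data into independent real Gaussian variables of variance
`v = xᵀ S x`, and `xᵀ Σ̂ x` into their sample variance. The deviations of `N` numbers from their
average form the orthogonal projection of the data vector on the hyperplane orthogonal to the
constants, and an orthogonal projection of a standard Gaussian vector is standard Gaussian on the
range; hence `(N - 1) xᵀ Σ̂ x` is distributed as `v q` with `q` chi-squared with `N - 1` degrees of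
freedom, including in the degenerate case `v = 0`. Since `v ≥ 0`, the inequality follows from
`|1 - q / (N - 1)| ≤ r₂ q / (N - 1)`, which holds as soon as `q` lies between the quantiles of
levels `β / 2` and `1 - β / 2`.
-/

open Filter Topology Module
open scoped BigOperators

section Quantile

variable (ν : Measure ℝ) {p q : ℝ}

theorem le_cdf_quantile (hp : p < 1) : p ≤ cdf ν (quantile ν p) := by
  have hne : {t : ℝ | p ≤ cdf ν t}.Nonempty :=
    ((tendsto_cdf_atTop ν).eventually (lt_mem_nhds hp)).exists.imp fun _ h ↦ h.le
  have hright : Tendsto (cdf ν) (𝓝[>] (quantile ν p)) (𝓝 (cdf ν (quantile ν p))) :=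
    ((cdf ν).right_continuous _).mono_left (nhdsWithin_mono _ Set.Ioi_subset_Ici_self)
  refine ge_of_tendsto hright ?_
  filter_upwards [self_mem_nhdsWithin] with s hs
  obtain ⟨t, ht, hts⟩ := exists_lt_of_csInf_lt hne hs
  exact ht.trans (monotone_cdf ν hts.le)

theorem quantile_le_of_le_cdf (hp : 0 < p) {t : ℝ} (ht : p ≤ cdf ν t) : quantile ν p ≤ t := by
  obtain ⟨a, ha⟩ := ((tendsto_cdf_atBot ν).eventually (gt_mem_nhds hp)).exists
  have hbdd : BddBelow {s : ℝ | p ≤ cdf ν s} :=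
    ⟨a, fun s hs ↦ ((monotone_cdf ν).reflect_lt (ha.trans_le hs)).le⟩
  exact csInf_le hbdd ht

theorem leftLim_cdf_quantile_le (hp : 0 < p) :
    Function.leftLim (cdf ν) (quantile ν p) ≤ p := by
  refine le_of_tendsto ((monotone_cdf ν).tendsto_leftLim _) ?_
  filter_upwards [self_mem_nhdsWithin] with s hs
  exact le_of_not_ge fun h ↦ (quantile_le_of_le_cdf ν hp h).not_gt hs

theorem lt_quantile_of_cdf_lt (hp : p < 1) {t : ℝ} (ht : cdf ν t < p) : t < quantile ν p :=
  (monotone_cdf ν).reflect_lt (ht.trans_le (le_cdf_quantile ν hp))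

theorem le_measure_Icc_quantile [IsProbabilityMeasure ν] (hp : 0 < p) (hq : q < 1) :
    ENNReal.ofReal (q - p) ≤ ν (Set.Icc (quantile ν p) (quantile ν q)) := by
  rw [← measure_cdf ν, StieltjesFunction.measure_Icc, measure_cdf ν]
  gcongr
  exacts [le_cdf_quantile ν hq, leftLim_cdf_quantile_le ν hp]

end Quantile

section ChiSquared

instance isProbabilityMeasure_chiSquared (k : ℕ) : IsProbabilityMeasure (chiSquared k) :=
  Measure.isProbabilityMeasure_map (Measurable.aemeasurable (by fun_prop))

theorem chiSquared_Iic_zero {k : ℕ} (hk : 0 < k) : chiSquared k (Set.Iic 0) = 0 := by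
  rw [chiSquared, Measure.map_apply (by fun_prop) measurableSet_Iic]
  have : NullSingletonClass (gaussianReal 0 1) := nullSingletonClass_gaussianReal one_ne_zero
  refine measure_mono_null (fun z (hz : ∑ i, z i ^ 2 ≤ 0) ↦ ?_)
    (Measure.pi_hyperplane (fun _ : Fin k ↦ gaussianReal 0 1) ⟨0, hk⟩ 0)
  have hcoord : z ⟨0, hk⟩ ^ 2 ≤ ∑ i, z i ^ 2 :=
    Finset.single_le_sum (fun i _ ↦ sq_nonneg (z i)) (Finset.mem_univ _)
  exact sq_nonpos_iff _ |>.1 (hcoord.trans hz)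

theorem chiSquaredQuantile_pos {k : ℕ} (hk : 0 < k) {p : ℝ} (hp : p ∈ Set.Ioo 0 1) :
    0 < chiSquaredQuantile k p := by
  refine lt_quantile_of_cdf_lt _ hp.2 ?_
  simpa [cdf_eq_real, measureReal_def, chiSquared_Iic_zero hk] using hp.1

variable {E : Type*} [NormedAddCommGroup E] [InnerProductSpace ℝ E] [FiniteDimensional ℝ E]
  [MeasurableSpace E] [BorelSpace E]

variable (E) in
theorem hasLaw_norm_sq_stdGaussian :
    HasLaw (fun y : E ↦ ‖y‖ ^ 2) (chiSquared (finrank ℝ E)) (stdGaussian E) where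
  map_eq := by
    rw [stdGaussian, Measure.map_map (by fun_prop) (by fun_prop), chiSquared]
    congr 1 with z
    rw [Function.comp_apply, ← EuclideanSpace.real_norm_sq_eq (WithLp.toLp 2 z),
      ← (stdOrthonormalBasis ℝ E).repr.symm.norm_map, ← (stdOrthonormalBasis ℝ E).sum_repr_symm]

theorem hasLaw_orthogonalProjectionOnto_stdGaussian (K : Submodule ℝ E) :
    HasLaw K.orthogonalProjectionOnto (stdGaussian K) (stdGaussian E) where
  map_eq := by
    refine Measure.ext_of_charFun (funext fun t ↦ ?_)
    calc charFun ((stdGaussian E).map K.orthogonalProjectionOnto) t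
        = charFun (stdGaussian E) (t : E) := by
          simp only [charFun_apply]
          rw [integral_map (by fun_prop) (by fun_prop)]
          simp only [Submodule.inner_orthogonalProjectionOnto_eq_of_mem_right]
      _ = charFun (stdGaussian K) t := by
          rw [charFun_stdGaussian, charFun_stdGaussian, K.coe_norm]

theorem hasLaw_norm_sq_starProjection_stdGaussian (K : Submodule ℝ E) :
    HasLaw (fun y : E ↦ ‖K.starProjection y‖ ^ 2) (chiSquared (finrank ℝ K)) (stdGaussian E) :=
  (hasLaw_norm_sq_stdGaussian K).comp (hasLaw_orthogonalProjectionOnto_stdGaussian K)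

end ChiSquared

section SumSqDev

variable {ι : Type*} [Fintype ι]

/-- The sum of the squared deviations of a finite family of real numbers from its average; divided
by `card ι - 1` it is the sample variance. -/
noncomputable def sumSqDev (y : ι → ℝ) : ℝ :=
  ∑ i, (y i - 𝔼 j, y j) ^ 2

theorem measurable_sumSqDev : Measurable (sumSqDev : (ι → ℝ) → ℝ) := by
  unfold sumSqDev
  simp only [Fintype.expect_eq_sum_div_card]
  fun_prop

theorem sumSqDev_const_mul_add_const [Nonempty ι] (c m : ℝ) (y : ι → ℝ) :
    sumSqDev (fun i ↦ c * y i + m) = c ^ 2 * sumSqDev y := by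
  simp only [sumSqDev, Finset.expect_add_distrib, Fintype.expect_const, ← Finset.mul_expect,
    add_sub_add_right_eq_sub, ← mul_sub, mul_pow, Finset.mul_sum]

theorem sumSqDev_eq_norm_sq_starProjection (y : ι → ℝ) :
    sumSqDev y =
      ‖(ℝ ∙ WithLp.toLp 2 (1 : ι → ℝ))ᗮ.starProjection (WithLp.toLp 2 y)‖ ^ 2 := by
  rw [Submodule.starProjection_orthogonal_val, Submodule.starProjection_singleton,
    EuclideanSpace.real_norm_sq_eq]
  simp [sumSqDev, Fintype.expect_eq_sum_div_card, PiLp.inner_apply,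
    EuclideanSpace.real_norm_sq_eq]

theorem hasLaw_sumSqDev_pi_gaussianReal [Nonempty ι] :
    HasLaw sumSqDev (chiSquared (Fintype.card ι - 1))
      (Measure.pi fun _ : ι ↦ gaussianReal 0 1) := by
  set u : EuclideanSpace ℝ ι := WithLp.toLp 2 1
  have hu : u ≠ 0 := by simp [u]
  have hdim : finrank ℝ (ℝ ∙ u)ᗮ = Fintype.card ι - 1 := by
    have := (ℝ ∙ u).finrank_add_finrank_orthogonal
    rw [finrank_span_singleton hu, finrank_euclideanSpace] at this
    omega
  have htoLp : HasLaw (WithLp.toLp 2) (stdGaussian (EuclideanSpace ℝ ι))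
      (Measure.pi fun _ ↦ gaussianReal 0 1) := ⟨by fun_prop, map_pi_eq_stdGaussian⟩
  rw [← hdim, funext sumSqDev_eq_norm_sq_starProjection]
  exact (hasLaw_norm_sq_starProjection_stdGaussian (ℝ ∙ u)ᗮ).comp htoLp

theorem hasLaw_const_mul_add_const_gaussianReal (m : ℝ) (v : NNReal) :
    HasLaw (fun z ↦ √v * z + m) (gaussianReal m v) (gaussianReal 0 1) := by
  have hvar : NNReal.mk (√v ^ 2) (sq_nonneg _) = v := NNReal.eq (Real.sq_sqrt v.coe_nonneg)
  have hid : HasLaw id (gaussianReal 0 1) (gaussianReal 0 1) := HasLaw.id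
  simpa [hvar] using gaussianReal_add_const (gaussianReal_const_mul hid (√v)) m

theorem hasLaw_sumSqDev [Nonempty ι] {Ω : Type*} [MeasurableSpace Ω] {P : Measure Ω} {m : ℝ}
    {v : NNReal} {X : ι → Ω → ℝ} (hX : ∀ i, HasLaw (X i) (gaussianReal m v) P)
    (hindep : iIndepFun X P) :
    HasLaw (fun ω ↦ sumSqDev fun i ↦ X i ω)
      ((chiSquared (Fintype.card ι - 1)).map (v * ·)) P := by
  have haffine := hasLaw_const_mul_add_const_gaussianReal m v
  have hstd : HasLaw (fun (z : ι → ℝ) i ↦ √v * z i + m) (Measure.pi fun _ ↦ gaussianReal m v)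
      (Measure.pi fun _ ↦ gaussianReal 0 1) :=
    ⟨Measurable.aemeasurable (by fun_prop), by
      rw [Measure.pi_map_pi fun _ ↦ haffine.aemeasurable, haffine.map_eq]⟩
  refine hstd.comp_of_hasLaw_comp measurable_sumSqDev.aemeasurable (hindep.hasLaw_pi hX) ?_
  simp only [sumSqDev_const_mul_add_const, Real.sq_sqrt v.coe_nonneg]
  exact HasLaw.fun_comp ⟨by fun_prop, rfl⟩ hasLaw_sumSqDev_pi_gaussianReal

end SumSqDev

section Projection

theorem hasLaw_dotProduct_multivariateGaussian {ι : Type*} [Fintype ι] [DecidableEq ι]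
    {μ : EuclideanSpace ℝ ι} {S : Matrix ι ι ℝ} (hS : S.PosSemidef) (x : ι → ℝ) :
    HasLaw (fun y : EuclideanSpace ℝ ι ↦ x ⬝ᵥ y)
      (gaussianReal (x ⬝ᵥ μ) (x ⬝ᵥ S *ᵥ x).toNNReal) (multivariateGaussian μ S) := by
  set L : StrongDual ℝ (EuclideanSpace ℝ ι) := innerSL ℝ (WithLp.toLp 2 x)
  have hL : ⇑L = fun y : EuclideanSpace ℝ ι ↦ x ⬝ᵥ y := by
    ext y
    simp [L, PiLp.inner_apply, dotProduct, mul_comm]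
  have hmean : (multivariateGaussian μ S)[L] = x ⬝ᵥ μ := by
    rw [L.integral_comp_id_comm IsGaussian.integrable_id, integral_id_multivariateGaussian, hL]
  have hvar : Var[L; multivariateGaussian μ S] = x ⬝ᵥ S *ᵥ x :=
    (covarianceBilin_self IsGaussian.memLp_two_id _).symm.trans
      (covarianceBilin_multivariateGaussian hS (WithLp.toLp 2 x) (WithLp.toLp 2 x))
  rw [← hL]
  exact ⟨by fun_prop, by rw [IsGaussian.map_eq_gaussianReal, hmean, hvar]⟩

theorem dotProduct_sampleMean {n N : ℕ} (d : Fin N → EuclideanSpace ℝ (Fin n)) (x : Fin n → ℝ) :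
    x ⬝ᵥ sampleMean d = 𝔼 i, x ⬝ᵥ d i := by
  rw [sampleMean, WithLp.ofLp_smul, WithLp.ofLp_sum, dotProduct_smul, dotProduct_sum, smul_eq_mul,
    one_div_mul_eq_div, Fintype.expect_eq_sum_div_card, Fintype.card_fin]

theorem dotProduct_sampleCovariance_mulVec {n N : ℕ} (d : Fin N → EuclideanSpace ℝ (Fin n))
    (x : Fin n → ℝ) :
    x ⬝ᵥ (sampleCovariance d *ᵥ x) = sumSqDev (fun i ↦ x ⬝ᵥ d i) / ((N : ℝ) - 1) := by
  have hrankOne (w : Fin n → ℝ) : x ⬝ᵥ vecMulVec w w *ᵥ x = (x ⬝ᵥ w) ^ 2 := by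
    rw [vecMulVec_mulVec, dotProduct_comm w x, op_smul_eq_smul, dotProduct_smul, smul_eq_mul, sq]
  rw [sampleCovariance, smul_mulVec, dotProduct_smul, sum_mulVec, dotProduct_sum, smul_eq_mul,
    one_div_mul_eq_div, sumSqDev]
  simp only [hrankOne, WithLp.ofLp_sub, dotProduct_sub, dotProduct_sampleMean]

end Projection

section ConfidenceInterval

theorem abs_one_sub_div_le {a b k q : ℝ} (ha : 0 < a) (hk : 0 < k) (hq : q ∈ Set.Icc a b) :
    |1 - q / k| ≤ q / k * max |1 - k / b| |1 - k / a| := by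
  have hq0 : 0 < q := ha.trans_le hq.1
  have hlower : k / b ≤ k / q := by gcongr; exact hq.2
  have hupper : k / q ≤ k / a := by gcongr; exact hq.1
  have hfactor : 1 - q / k = q / k * -(1 - k / q) := by field_simp; ring
  calc |1 - q / k| = q / k * |1 - k / q| := by
        rw [hfactor, abs_mul, abs_neg, abs_of_pos (div_pos hq0 hk)]
    _ ≤ q / k * max |1 - k / b| |1 - k / a| := by
        rw [max_comm]
        gcongr
        exact abs_le_max_abs_abs (by linarith) (by linarith)

theorem le_chiSquared_abs_one_sub_div_le {N : ℕ} (hN : 2 ≤ N) {β : ℝ} (hβ : β ∈ Set.Ioo 0 1) :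
    ENNReal.ofReal (1 - β) ≤ chiSquared (N - 1)
      {q | |1 - q / ((N : ℝ) - 1)| ≤ q / ((N : ℝ) - 1) * covarianceRadius N β} := by
  obtain ⟨hβ0, hβ1⟩ := hβ
  have hN' : 0 < (N : ℝ) - 1 := by
    rw [← Nat.cast_pred (by omega)]
    exact_mod_cast Nat.sub_pos_of_lt hN
  have hquantile : 0 < chiSquaredQuantile (N - 1) (β / 2) :=
    chiSquaredQuantile_pos (by omega) ⟨by linarith, by linarith⟩
  calc ENNReal.ofReal (1 - β) = ENNReal.ofReal (1 - β / 2 - β / 2) := by ring_nf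
    _ ≤ chiSquared (N - 1) (Set.Icc (chiSquaredQuantile (N - 1) (β / 2))
          (chiSquaredQuantile (N - 1) (1 - β / 2))) :=
        le_measure_Icc_quantile _ (by linarith) (by linarith)
    _ ≤ _ := measure_mono fun _ ↦ abs_one_sub_div_le hquantile hN'

end ConfidenceInterval

theorem lemma3 {Ω : Type*} [MeasurableSpace Ω] (P : Measure Ω) [IsProbabilityMeasure P]
    {n N : ℕ} (hN : 2 ≤ N)
    (μ : EuclideanSpace ℝ (Fin n)) (S : Matrix (Fin n) (Fin n) ℝ) (hS : S.PosSemidef)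
    (d : Fin N → Ω → EuclideanSpace ℝ (Fin n))
    (hd : ∀ i, HasLaw (d i) (multivariateGaussian μ S) P)
    (hindep : iIndepFun d P)
    (β : ℝ) (hβ : β ∈ Set.Ioo (0 : ℝ) 1) (x : Fin n → ℝ) :
    ENNReal.ofReal (1 - β) ≤
      P {ω | |x ⬝ᵥ ((S - sampleCovariance fun i => d i ω) *ᵥ x)| ≤
        (x ⬝ᵥ ((sampleCovariance fun i => d i ω) *ᵥ x)) * covarianceRadius N β} := by
  have : NeZero N := ⟨by omega⟩
  have hv : 0 ≤ x ⬝ᵥ S *ᵥ x := by simpa using hS.dotProduct_mulVec_nonneg x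
  have hX (i) := (hasLaw_dotProduct_multivariateGaussian hS x).fun_comp (hd i)
  have hXindep : iIndepFun (fun i ω ↦ x ⬝ᵥ d i ω) P :=
    hindep.comp (fun _ y ↦ x ⬝ᵥ y) fun _ ↦ by unfold dotProduct; fun_prop
  have hlaw := hasLaw_sumSqDev hX hXindep
  rw [Fintype.card_fin, Real.coe_toNNReal _ hv] at hlaw
  simp only [sub_mulVec, dotProduct_sub, dotProduct_sampleCovariance_mulVec]
  set v := x ⬝ᵥ S *ᵥ x
  set r := covarianceRadius N β
  have hmeas : MeasurableSet {t | |v - t / ((N : ℝ) - 1)| ≤ t / ((N : ℝ) - 1) * r} :=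
    measurableSet_le (by fun_prop) (by fun_prop)
  rw [hlaw.measure_eq hmeas, Measure.map_apply (by fun_prop) hmeas]
  refine (le_chiSquared_abs_one_sub_div_le hN hβ).trans (measure_mono fun q hq ↦ ?_)
  calc |v - v * q / ((N : ℝ) - 1)| = v * |1 - q / ((N : ℝ) - 1)| := by
        rw [mul_div_assoc, ← mul_one_sub, abs_mul, abs_of_nonneg hv]
    _ ≤ v * (q / ((N : ℝ) - 1) * r) := by gcongr; exact hq
    _ = v * q / ((N : ℝ) - 1) * r := by ring
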